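/- Let $d,r,T$ be natural numbers, $\mathbf X,\mathbf Y\in\mathbb R^{d\times T}$, $\xi\ge 0$, $\lambda\ge 0$, $\lambda_1,\lambda_2>0$. Let $\psi$ be one of the following functions on $\mathbb R^{r\times T}$: (a) $\psi(\mathbf H)=\|\mathbf H\|_F^2$ (Ridge); (b) $\psi(\mathbf H)=\|\mathbf H\|_1=\sum_{s,t}|\mathbf H[s,t]|$ (Lasso); (c) $\psi(\mathbf H)=\sum_{s,k}\bigl(|\operatorname{Re}\widehat{\mathbf H}[s,k]|+|\operatorname{Im}\widehat{\mathbf H}[s,k]|\bigr)$ with $\widehat{\mathbf H}[s,k]=\frac1T\sum_{f=0}^{T-1}\mathbf H[s,f]e^{-2\pi i fk/T}$ (soft frequency regularization). Consider the problem of minimizing $$f(\mathbf H,\mathbf W,\mathbf W')=\|\mathbf X-\mathbf W\mathbf H\|_F^2+\xi\|\mathbf Y-\mathbf W'\mathbf H\|_F^2+\lambda\psi(\mathbf H)+\lambda_1\|\mathbf W\|_F^2+\lambda_2\|\mathbf W'\|_F^2$$ over $\mathbf H\in\mathbb R^{r\times T}_{\ge0}$ and $\mathbf W,\mathbf W'\in\mathbb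 R^{d\times r}$. A feasible point $x$ is called stationary if $\liminf_{t\downarrow0}\frac{f(x+t(y-x))-f(x)}{t}\ge0$ for every feasible $y$. Block coordinate descent starts from an arbitrary triple $(\mathbf H_0,\mathbf W_0,\mathbf W'_0)$ of real matrices and chooses, for $j\ge1$, $$\mathbf H_j\in\operatorname*{argmin}_{\mathbf H\ge0}f(\mathbf H,\mathbf W_{j-1},\mathbf W'_{j-1}),\qquad \mathbf W_j=\operatorname*{argmin}_{\mathbf W}f(\mathbf H_j,\mathbf W,\mathbf W'_{j-1}),\qquad \mathbf W'_j=\operatorname*{argmin}_{\mathbf W'}f(\mathbf H_j,\mathbf W_j,\mathbf W').$$ Then: 1. Projected subgradient descent solves the $\mathbf H$-subproblem: for all $\mathbf W,\mathbf W'$ and all step sizes $\alpha_k>0$ with $\sum_k\alpha_k=\infty$ and $\sum_k\alpha_k^2<\infty$, the method $h_{k+1}=\max\{0,h_k-\alpha_kg_k\}$ (entrywise maximum), where $g_k$ is a subgradient of $\mathbf H\mapsto f(\mathbf H,\mathbf W,\mathbf W')$ at $h_k$, can be run from every $h_0\in\mathbb R^{r\times T}$, and every sequence $(h_k)$ so generated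 converges to a minimizer of $f(\cdot,\mathbf W,\mathbf W')$ over $\mathbb R^{r\times T}_{\ge0}$. 2. Block coordinate descent can be run from every initialization. 3. For every sequence generated by block coordinate descent, every cluster point of $(\mathbf H_j,\mathbf W_j,\mathbf W'_j)_j$ is a stationary point. If $\lambda>0$, then moreover the iterates stay in a compact set and they converge to the set of stationary points, i.e. every neighbourhood of this set contains $(\mathbf H_j,\mathbf W_j,\mathbf W'_j)$ for all sufficiently large $j$. -/

import Mathlib

open Filter Topology

namespace SSNMF

/-- Squared Frobenius norm. -/
def frobSq {m n : ℕ} (A : Matrix (Fin m) (Fin n) ℝ) : ℝ :=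
  ∑ i, ∑ j, A i j ^ 2

/-- Entrywise `ℓ¹` norm. -/
def l1Norm {m n : ℕ} (A : Matrix (Fin m) (Fin n) ℝ) : ℝ :=
  ∑ i, ∑ j, |A i j|

/-- Entrywise (Frobenius) inner product. -/
def frobInner {m n : ℕ} (A B : Matrix (Fin m) (Fin n) ℝ) : ℝ :=
  ∑ i, ∑ j, A i j * B i j

/-- The `T × T` Fourier matrix, with entries `exp (-2 π i f k / T) / T`. -/
noncomputable def fourierMatrix (T : ℕ) : Matrix (Fin T) (Fin T) ℂ :=
  Matrix.of fun f k =>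
    Complex.exp (-2 * (Real.pi : ℂ) * Complex.I * ((f : ℕ) : ℂ) * ((k : ℕ) : ℂ) / (T : ℂ)) / (T : ℂ)

/-- Row-wise discrete Fourier transform of a real matrix: `A` times the Fourier matrix. -/
noncomputable def dft {m T : ℕ} (A : Matrix (Fin m) (Fin T) ℝ) : Matrix (Fin m) (Fin T) ℂ :=
  A.map Complex.ofReal * fourierMatrix T

/-- Minkowski 1-norm of a complex matrix: the sum of `|Re| + |Im|` over the entries. -/
def minkowskiNorm {m n : ℕ} (C : Matrix (Fin m) (Fin n) ℂ) : ℝ :=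
  ∑ i, ∑ j, (|(C i j).re| + |(C i j).im|)

/-- The three choices of regularization of the temporal factor. -/
inductive Regularizer where
  | ridge
  | lasso
  | softFrequency

/-- The penalty function (without its weight) attached to a regularizer. -/
noncomputable def Regularizer.penalty {r T : ℕ} :
    Regularizer → Matrix (Fin r) (Fin T) ℝ → ℝ
  | .ridge, H => frobSq H
  | .lasso, H => l1Norm H
  | .softFrequency, H => minkowskiNorm (dft H)

/-- Data of an instance: `X` and `Y` (restricted to the observation period), the supervision
parameter `xi`, the regularizer with its weight `lam`, and the weights `lam₁`, `lam₂` of the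
squared Frobenius penalties on `W` and `W'`. -/
structure Problem (d r T : ℕ) where
  X : Matrix (Fin d) (Fin T) ℝ
  Y : Matrix (Fin d) (Fin T) ℝ
  xi : ℝ
  reg : Regularizer
  lam : ℝ
  lam₁ : ℝ
  lam₂ : ℝ

/-- The entrywise nonnegative matrices. -/
def nonnegSet (r T : ℕ) : Set (Matrix (Fin r) (Fin T) ℝ) :=
  {H | ∀ s t, 0 ≤ H s t}

/-- The space of triples `(H, W, W')`. -/
abbrev Triple (d r T : ℕ) : Type :=
  Matrix (Fin r) (Fin T) ℝ × Matrix (Fin d) (Fin r) ℝ × Matrix (Fin d) (Fin r) ℝ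

/-- The feasible triples: `H` is nonnegative, `W` and `W'` are unconstrained. -/
def feasibleSet (d r T : ℕ) : Set (Triple d r T) :=
  {z | z.1 ∈ nonnegSet r T}

/-- `x` is one of the minimizers of `f` over `C`. -/
def IsArgmin {E : Type*} (f : E → ℝ) (C : Set E) (x : E) : Prop :=
  x ∈ C ∧ IsMinOn f C x

/-- `x` is a (first-order) stationary point of `f` on the convex set `C`: it lies in `C`, and
the lower one-sided directional derivative
`liminf_{t ↓ 0} (f (x + t (y - x)) - f x) / t` is nonnegative for every `y ∈ C`. -/
def IsStationary {E : Type*} [AddCommGroup E] [Module ℝ E] (f : E → ℝ) (C : Set E) (x : E) :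
    Prop :=
  x ∈ C ∧ ∀ y ∈ C, ∀ ε : ℝ, 0 < ε →
    ∀ᶠ t : ℝ in 𝓝[>] 0, -ε ≤ (f (x + t • (y - x)) - f x) / t

/-- `g` is a subgradient of `f` at `x`. -/
def IsSubgradient {m n : ℕ} (f : Matrix (Fin m) (Fin n) ℝ → ℝ)
    (x g : Matrix (Fin m) (Fin n) ℝ) : Prop :=
  ∀ y, f x + frobInner g (y - x) ≤ f y

/-- Projection onto the entrywise nonnegative matrices. -/
def projNonneg {m n : ℕ} (A : Matrix (Fin m) (Fin n) ℝ) : Matrix (Fin m) (Fin n) ℝ :=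
  A.map fun a => max 0 a

/-- Positive step sizes that are square-summable but not summable. -/
def IsStepSize (α : ℕ → ℝ) : Prop :=
  (∀ k, 0 < α k) ∧ ¬ Summable α ∧ Summable fun k => α k ^ 2

/-- `h` is generated by the projected subgradient method for minimizing `f` over the
nonnegative matrices, with step sizes `α` and an arbitrary subgradient at each step. -/
def IsProjectedSubgradient {m n : ℕ} (f : Matrix (Fin m) (Fin n) ℝ → ℝ) (α : ℕ → ℝ)
    (h : ℕ → Matrix (Fin m) (Fin n) ℝ) : Prop :=
  ∀ k, ∃ g, IsSubgradient f (h k) g ∧ h (k + 1) = projNonneg (h k - α k • g)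

namespace Problem

variable {d r T : ℕ}

/-- The objective function with the squared Frobenius penalties on `W` and `W'`. -/
noncomputable def objective (P : Problem d r T) (z : Triple d r T) : ℝ :=
  frobSq (P.X - z.2.1 * z.1) + P.xi * frobSq (P.Y - z.2.2 * z.1) + P.lam * P.reg.penalty z.1
    + P.lam₁ * frobSq z.2.1 + P.lam₂ * frobSq z.2.2

/-- Objective of the `H`-subproblem. -/
noncomputable def objH (P : Problem d r T) (W W' : Matrix (Fin d) (Fin r) ℝ)
    (H : Matrix (Fin r) (Fin T) ℝ) : ℝ :=
  frobSq (P.X - W * H) + P.xi * frobSq (P.Y - W' * H) + P.lam * P.reg.penalty H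

/-- Objective of the `W`-subproblem. -/
def objW (P : Problem d r T) (H : Matrix (Fin r) (Fin T) ℝ)
    (W : Matrix (Fin d) (Fin r) ℝ) : ℝ :=
  frobSq (P.X - W * H) + P.lam₁ * frobSq W

/-- Objective of the `W'`-subproblem. -/
def objW' (P : Problem d r T) (H : Matrix (Fin r) (Fin T) ℝ)
    (W' : Matrix (Fin d) (Fin r) ℝ) : ℝ :=
  P.xi * frobSq (P.Y - W' * H) + P.lam₂ * frobSq W'

/-- The stationary points of the constrained problem. -/
def stationarySet (P : Problem d r T) : Set (Triple d r T) :=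
  {z | IsStationary P.objective (feasibleSet d r T) z}

/-- `z j = (H_j, W_j, W'_j)` is generated by block coordinate descent: first `H`, then `W`,
then `W'` is replaced by a minimizer of its subproblem.  Index `0` is the initialization. -/
structure IsBCD (P : Problem d r T) (z : ℕ → Triple d r T) : Prop where
  stepH : ∀ j, IsArgmin (P.objH (z j).2.1 (z j).2.2) (nonnegSet r T) (z (j + 1)).1
  stepW : ∀ j, IsArgmin (P.objW (z (j + 1)).1) Set.univ (z (j + 1)).2.1
  stepW' : ∀ j, IsArgmin (P.objW' (z (j + 1)).1) Set.univ (z (j + 1)).2.2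

end Problem

end SSNMF

/-! For fixed factors `W`, `W'` the objective in `H` is nonnegative, has subgradients everywhere and
grows at most quadratically. This forces `‖g‖² ≤ c (1 + ‖x‖²)` for every subgradient, which replaces
the usual Lipschitz assumption. The squared distance from the projected iterates to any minimizer
then obeys a Robbins–Siegmund recursion: it converges, and the step-weighted optimality gaps are
summable. As the step sizes are not, some cluster point is a minimizer, and the distance to that
point must tend to `0`. A minimizer exists by coercivity if `λ > 0`; for `λ = 0` the sublevel sets
may be unbounded, and `exists_isArgmin_leastSquares` removes the directions along which the
objective is constant.

For block coordinate descent, the ridge terms make the `W` and `W'` problems strongly convex, so the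
decrease of the objective controls the squared moves of `W` and `W'`, which therefore vanish. Hence
at a cluster point all three argmin conditions pass to the limit, and the limit is minimal in each
block. Such a point is stationary because the nonsmooth term involves `H` alone, while the coupling
between blocks is of second order along any line (`exists_mixed_difference_eq`). For `λ > 0` the
sublevel sets are bounded, and compactness gives convergence to the stationary set. -/

namespace SSNMF

/-! ### Frobenius calculus and compactness of boxes. -/

section Frobenius

variable {m n p : ℕ}

lemma frobSq_nonneg (A : Matrix (Fin m) (Fin n) ℝ) : 0 ≤ frobSq A :=
  Finset.sum_nonneg fun _ _ => Finset.sum_nonneg fun _ _ => sq_nonneg _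

lemma sq_apply_le_frobSq (A : Matrix (Fin m) (Fin n) ℝ) (i : Fin m) (j : Fin n) :
    A i j ^ 2 ≤ frobSq A :=
  (Finset.single_le_sum (f := fun j => A i j ^ 2) (fun _ _ => sq_nonneg _)
    (Finset.mem_univ j)).trans
    (Finset.single_le_sum (f := fun i => ∑ j, A i j ^ 2)
      (fun _ _ => Finset.sum_nonneg fun _ _ => sq_nonneg _) (Finset.mem_univ i))

lemma abs_apply_le_one_add_frobSq (A : Matrix (Fin m) (Fin n) ℝ) (i : Fin m) (j : Fin n) :
    |A i j| ≤ 1 + frobSq A := by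
  have h := sq_apply_le_frobSq A i j
  rw [← sq_abs] at h
  nlinarith [sq_nonneg (|A i j| - 1)]

lemma eq_zero_of_frobSq_eq_zero {A : Matrix (Fin m) (Fin n) ℝ} (h : frobSq A = 0) : A = 0 := by
  ext i j
  have := sq_apply_le_frobSq A i j
  rw [h] at this
  exact pow_eq_zero_iff (two_ne_zero) |>.1 (le_antisymm this (sq_nonneg _))

lemma frobSq_zero : frobSq (0 : Matrix (Fin m) (Fin n) ℝ) = 0 := by
  simp [frobSq]

lemma frobSq_sub (A B : Matrix (Fin m) (Fin n) ℝ) :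
    frobSq (A - B) = frobSq A - 2 * frobInner A B + frobSq B := by
  simp only [frobSq, frobInner, Finset.mul_sum, ← Finset.sum_sub_distrib,
    ← Finset.sum_add_distrib, Matrix.sub_apply]
  exact Finset.sum_congr rfl fun _ _ => Finset.sum_congr rfl fun _ _ => by ring

lemma frobSq_smul (c : ℝ) (A : Matrix (Fin m) (Fin n) ℝ) : frobSq (c • A) = c ^ 2 * frobSq A := by
  simp only [frobSq, Finset.mul_sum, Matrix.smul_apply, smul_eq_mul, mul_pow]

lemma frobInner_self (A : Matrix (Fin m) (Fin n) ℝ) : frobInner A A = frobSq A := by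
  simp only [frobSq, frobInner, sq]

lemma frobInner_smul_left (c : ℝ) (A B : Matrix (Fin m) (Fin n) ℝ) :
    frobInner (c • A) B = c * frobInner A B := by
  simp only [frobInner, Finset.mul_sum, Matrix.smul_apply, smul_eq_mul, mul_assoc]

lemma frobInner_comm (A B : Matrix (Fin m) (Fin n) ℝ) : frobInner A B = frobInner B A := by
  simp only [frobInner, mul_comm]

lemma frobInner_smul_right (c : ℝ) (A B : Matrix (Fin m) (Fin n) ℝ) :
    frobInner A (c • B) = c * frobInner A B := by
  rw [frobInner_comm, frobInner_smul_left, frobInner_comm]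

lemma frobInner_add_left (A B C : Matrix (Fin m) (Fin n) ℝ) :
    frobInner (A + B) C = frobInner A C + frobInner B C := by
  simp only [frobInner, Matrix.add_apply, add_mul, Finset.sum_add_distrib]

lemma frobInner_neg_right (A B : Matrix (Fin m) (Fin n) ℝ) :
    frobInner A (-B) = -frobInner A B := by
  simp [frobInner]

lemma frobInner_sub_right (A B C : Matrix (Fin m) (Fin n) ℝ) :
    frobInner A (B - C) = frobInner A B - frobInner A C := by
  simp only [frobInner, Matrix.sub_apply, mul_sub, Finset.sum_sub_distrib]

lemma frobSq_add_le (A B : Matrix (Fin m) (Fin n) ℝ) :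
    frobSq (A + B) ≤ 2 * frobSq A + 2 * frobSq B := by
  simp only [frobSq, Finset.mul_sum, ← Finset.sum_add_distrib, Matrix.add_apply]
  exact Finset.sum_le_sum fun _ _ => Finset.sum_le_sum fun i j => by
    nlinarith [sq_nonneg (A ‹_› i - B ‹_› i)]

lemma frobSq_sub_le (A B : Matrix (Fin m) (Fin n) ℝ) :
    frobSq (A - B) ≤ 2 * frobSq A + 2 * frobSq B := by
  have := frobSq_add_le A ((-1 : ℝ) • B)
  rw [frobSq_smul] at this
  simpa [sub_eq_add_neg] using this

lemma frobSq_midpoint (A B : Matrix (Fin m) (Fin n) ℝ) :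
    frobSq ((1 / 2 : ℝ) • (A + B)) = (frobSq A + frobSq B) / 2 - frobSq (A - B) / 4 := by
  simp only [frobSq, ← Finset.sum_add_distrib, Finset.sum_div, ← Finset.sum_sub_distrib,
    Matrix.sub_apply, Matrix.smul_apply, Matrix.add_apply, smul_eq_mul]
  exact Finset.sum_congr rfl fun _ _ => Finset.sum_congr rfl fun _ _ => by ring

lemma abs_frobInner_le (A B : Matrix (Fin m) (Fin n) ℝ) :
    |frobInner A B| ≤ frobSq A + frobSq B := by
  refine (Finset.abs_sum_le_sum_abs _ _).trans ?_
  simp only [frobSq, ← Finset.sum_add_distrib]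
  refine Finset.sum_le_sum fun i _ =>
    (Finset.abs_sum_le_sum_abs _ _).trans (Finset.sum_le_sum fun j _ => ?_)
  rw [abs_le]
  constructor <;> nlinarith [sq_nonneg (A i j - B i j), sq_nonneg (A i j + B i j)]

lemma frobSq_mul_le (A : Matrix (Fin m) (Fin n) ℝ) (B : Matrix (Fin n) (Fin p) ℝ) :
    frobSq (A * B) ≤ frobSq A * frobSq B := by
  simp only [frobSq]
  rw [Finset.sum_mul]
  refine Finset.sum_le_sum fun i _ => ?_
  rw [Finset.sum_comm (f := fun a b => B a b ^ 2), Finset.mul_sum]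
  refine Finset.sum_le_sum fun j _ => ?_
  rw [Matrix.mul_apply]
  exact Finset.sum_mul_sq_le_sq_mul_sq _ _ _

lemma frobInner_mul_right (A : Matrix (Fin m) (Fin p) ℝ) (W : Matrix (Fin m) (Fin n) ℝ)
    (B : Matrix (Fin n) (Fin p) ℝ) :
    frobInner A (W * B) = frobInner (W.transpose * A) B := by
  simp only [frobInner, Matrix.mul_apply, Matrix.transpose_apply, Finset.mul_sum, Finset.sum_mul]
  have h1 : ∀ i, ∑ j, ∑ k, A i j * (W i k * B k j) = ∑ k, ∑ j, A i j * (W i k * B k j) :=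
    fun i => Finset.sum_comm
  simp only [h1]
  rw [Finset.sum_comm]
  refine Finset.sum_congr rfl fun k _ => ?_
  rw [Finset.sum_comm]
  exact Finset.sum_congr rfl fun _ _ => Finset.sum_congr rfl fun _ _ => by ring

lemma continuous_frobSq : Continuous (frobSq : Matrix (Fin m) (Fin n) ℝ → ℝ) := by
  unfold frobSq
  exact continuous_finsetSum _ fun i _ => continuous_finsetSum _ fun j _ =>
    (continuous_id.matrix_elem i j).pow 2

lemma continuous_frobInner (A : Matrix (Fin m) (Fin n) ℝ) : Continuous (frobInner A) := by
  unfold frobInner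
  exact continuous_finsetSum _ fun i _ => continuous_finsetSum _ fun j _ =>
    continuous_const.mul (continuous_id.matrix_elem i j)

lemma tendsto_of_apply {ι : Type*} {l : Filter ι} {u : ι → Matrix (Fin m) (Fin n) ℝ}
    {A : Matrix (Fin m) (Fin n) ℝ} (h : ∀ i j, Tendsto (fun k => u k i j) l (𝓝 (A i j))) :
    Tendsto u l (𝓝 A) :=
  tendsto_pi_nhds.2 fun i => tendsto_pi_nhds.2 fun j => h i j

lemma tendsto_apply {ι : Type*} {l : Filter ι} {u : ι → Matrix (Fin m) (Fin n) ℝ}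
    {A : Matrix (Fin m) (Fin n) ℝ} (h : Tendsto u l (𝓝 A)) (i : Fin m) (j : Fin n) :
    Tendsto (fun k => u k i j) l (𝓝 (A i j)) :=
  ((continuous_id.matrix_elem i j).tendsto A).comp h

lemma tendsto_zero_of_frobSq {ι : Type*} {l : Filter ι} {u : ι → Matrix (Fin m) (Fin n) ℝ}
    (h : Tendsto (fun k => frobSq (u k)) l (𝓝 0)) : Tendsto u l (𝓝 0) := by
  refine tendsto_of_apply fun i j => ?_
  have h2 : Tendsto (fun k => Real.sqrt (frobSq (u k))) l (𝓝 0) := by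
    simpa [Function.comp_def] using (Real.continuous_sqrt.tendsto 0).comp h
  exact squeeze_zero_norm (fun k => Real.abs_le_sqrt (sq_apply_le_frobSq (u k) i j)) h2

lemma tendsto_of_frobSq_sub {ι : Type*} {l : Filter ι} {u : ι → Matrix (Fin m) (Fin n) ℝ}
    {A : Matrix (Fin m) (Fin n) ℝ} (h : Tendsto (fun k => frobSq (u k - A)) l (𝓝 0)) :
    Tendsto u l (𝓝 A) := by
  simpa using (tendsto_zero_of_frobSq h).add_const A

instance : FirstCountableTopology (Matrix (Fin m) (Fin n) ℝ) :=
  inferInstanceAs (FirstCountableTopology (Fin m → Fin n → ℝ))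

/-- The matrices all of whose entries have absolute value at most `R`. -/
def entryBox (m n : ℕ) (R : ℝ) : Set (Matrix (Fin m) (Fin n) ℝ) :=
  {A | ∀ i j, |A i j| ≤ R}

lemma isCompact_entryBox (m n : ℕ) (R : ℝ) : IsCompact (entryBox m n R) := by
  have h : IsCompact (Set.univ.pi fun _ : Fin m => Set.univ.pi fun _ : Fin n => Set.Icc (-R) R) :=
    isCompact_univ_pi fun _ => isCompact_univ_pi fun _ => isCompact_Icc
  have e : entryBox m n R =
      Set.univ.pi fun _ : Fin m => Set.univ.pi fun _ : Fin n => Set.Icc (-R) R := by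
    refine Set.ext fun A => ?_
    exact (Set.mem_univ_pi.trans (forall_congr' fun i =>
      Set.mem_univ_pi.trans (forall_congr' fun j => abs_le.symm))).symm
  rw [e]
  exact h

lemma isClosed_nonnegSet (m n : ℕ) : IsClosed (nonnegSet m n) := by
  simp only [nonnegSet, Set.ofPred_forall]
  exact isClosed_iInter fun i => isClosed_iInter fun j =>
    isClosed_le continuous_const (continuous_id.matrix_elem i j)

lemma zero_mem_nonnegSet (m n : ℕ) : (0 : Matrix (Fin m) (Fin n) ℝ) ∈ nonnegSet m n :=
  fun _ _ => le_rfl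

lemma projNonneg_mem (A : Matrix (Fin m) (Fin n) ℝ) : projNonneg A ∈ nonnegSet m n :=
  fun _ _ => le_max_left _ _

lemma frobSq_projNonneg_sub_le (A : Matrix (Fin m) (Fin n) ℝ) {C : Matrix (Fin m) (Fin n) ℝ}
    (hC : C ∈ nonnegSet m n) : frobSq (projNonneg A - C) ≤ frobSq (A - C) := by
  refine Finset.sum_le_sum fun i _ => Finset.sum_le_sum fun j _ => ?_
  have h := hC i j
  simp only [Matrix.sub_apply, projNonneg, Matrix.map_apply]
  rcases max_cases 0 (A i j) with ⟨h1, h2⟩ | ⟨h1, h2⟩ <;> rw [h1]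
  nlinarith

end Frobenius

/-! ### Existence of minimizers, functions of quadratic growth, and the Robbins–Siegmund recursion.
-/

lemma exists_isArgmin_of_sublevel_subset {E : Type*} [TopologicalSpace E] {F : E → ℝ}
    (hF : Continuous F) {C K : Set E} (hC : IsClosed C) (hK : IsCompact K) {x₀ : E}
    (hx₀ : x₀ ∈ C) (h : ∀ x ∈ C, F x ≤ F x₀ → x ∈ K) : ∃ x, IsArgmin F C x := by
  have hc : IsCompact (K ∩ (C ∩ {x | F x ≤ F x₀})) :=
    hK.inter_right (hC.inter (isClosed_le hF continuous_const))
  obtain ⟨x, hx, hmin⟩ := hc.exists_isMinOn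
    ⟨x₀, h x₀ hx₀ le_rfl, hx₀, le_refl (F x₀)⟩ hF.continuousOn
  refine ⟨x, hx.2.1, fun y hy => ?_⟩
  by_cases hy' : F y ≤ F x₀
  · exact hmin ⟨h y hy hy', hy, hy'⟩
  · exact hx.2.2.trans (not_le.1 hy').le

/-- Nonnegative functions of at most quadratic growth with subgradients everywhere. -/
structure IsAdmissible {m n : ℕ} (F : Matrix (Fin m) (Fin n) ℝ → ℝ) : Prop where
  nonneg : ∀ x, 0 ≤ F x
  growth : ∃ c, ∀ x, F x ≤ c * (1 + frobSq x)
  continuous : Continuous F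
  subgradient : ∀ x, ∃ g, IsSubgradient F x g

namespace IsAdmissible

variable {m n : ℕ} {F G : Matrix (Fin m) (Fin n) ℝ → ℝ}

lemma add (hF : IsAdmissible F) (hG : IsAdmissible G) : IsAdmissible fun x => F x + G x where
  nonneg x := add_nonneg (hF.nonneg x) (hG.nonneg x)
  growth := by
    obtain ⟨a, ha⟩ := hF.growth
    obtain ⟨b, hb⟩ := hG.growth
    exact ⟨a + b, fun x => by linarith [ha x, hb x]⟩
  continuous := hF.continuous.add hG.continuous
  subgradient x := by
    obtain ⟨a, ha⟩ := hF.subgradient x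
    obtain ⟨b, hb⟩ := hG.subgradient x
    exact ⟨a + b, fun y => by rw [frobInner_add_left]; linarith [ha y, hb y]⟩

lemma const_mul (hF : IsAdmissible F) {c : ℝ} (hc : 0 ≤ c) : IsAdmissible fun x => c * F x where
  nonneg x := mul_nonneg hc (hF.nonneg x)
  growth := by
    obtain ⟨a, ha⟩ := hF.growth
    exact ⟨c * a, fun x => by rw [mul_assoc]; exact mul_le_mul_of_nonneg_left (ha x) hc⟩
  continuous := continuous_const.mul hF.continuous
  subgradient x := by
    obtain ⟨a, ha⟩ := hF.subgradient x
    refine ⟨c • a, fun y => ?_⟩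
    rw [frobInner_smul_left, ← mul_add]
    exact mul_le_mul_of_nonneg_left (ha y) hc

lemma zero : IsAdmissible fun _ : Matrix (Fin m) (Fin n) ℝ => (0 : ℝ) where
  nonneg _ := le_rfl
  growth := ⟨0, fun x => by simp⟩
  continuous := continuous_const
  subgradient _ := ⟨0, fun y => by simp [frobInner]⟩

lemma sum {ι : Type*} (s : Finset ι) {F : ι → Matrix (Fin m) (Fin n) ℝ → ℝ}
    (h : ∀ i ∈ s, IsAdmissible (F i)) : IsAdmissible fun x => ∑ i ∈ s, F i x := by
  classical
  induction s using Finset.induction_on with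
  | empty => simpa using zero
  | insert a s ha ih =>
    simp only [Finset.sum_insert ha]
    exact (h a (Finset.mem_insert_self a s)).add
      (ih fun i hi => h i (Finset.mem_insert_of_mem hi))

lemma abs_frobInner (A : Matrix (Fin m) (Fin n) ℝ) : IsAdmissible fun x => |frobInner A x| where
  nonneg _ := abs_nonneg _
  growth := ⟨1 + frobSq A, fun x => by
    nlinarith [abs_frobInner_le A x, frobSq_nonneg A, frobSq_nonneg x,
      mul_nonneg (frobSq_nonneg A) (frobSq_nonneg x)]⟩
  continuous := (continuous_frobInner A).abs
  subgradient x := by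
    rcases le_total 0 (frobInner A x) with h | h
    · refine ⟨A, fun y => ?_⟩
      beta_reduce
      rw [frobInner_sub_right, abs_of_nonneg h]
      linarith [le_abs_self (frobInner A y)]
    · refine ⟨(-1 : ℝ) • A, fun y => ?_⟩
      beta_reduce
      rw [frobInner_smul_left, frobInner_sub_right, abs_of_nonpos h]
      linarith [neg_le_abs (frobInner A y)]

lemma frobSq_sub_mul {d : ℕ} (X : Matrix (Fin d) (Fin n) ℝ) (W : Matrix (Fin d) (Fin m) ℝ) :
    IsAdmissible fun H : Matrix (Fin m) (Fin n) ℝ => frobSq (X - W * H) where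
  nonneg _ := frobSq_nonneg _
  growth := ⟨2 * frobSq X + 2 * frobSq W, fun H => by
    have h₁ : frobSq (X - W * H) ≤ 2 * frobSq X + 2 * frobSq (W * H) := frobSq_sub_le X (W * H)
    nlinarith [frobSq_mul_le W H, mul_nonneg (frobSq_nonneg X) (frobSq_nonneg H),
      frobSq_nonneg W]⟩
  continuous := continuous_frobSq.comp
    (continuous_const.sub (continuous_const.matrix_mul continuous_id))
  subgradient H := by
    refine ⟨(-2 : ℝ) • (W.transpose * (X - W * H)), fun y => ?_⟩
    beta_reduce
    have h : X - W * y = (X - W * H) - W * (y - H) := by rw [Matrix.mul_sub]; abel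
    rw [h, frobSq_sub (X - W * H), frobInner_mul_right, frobInner_smul_left]
    linarith [frobSq_nonneg (W * (y - H))]

lemma frobSq_self : IsAdmissible (frobSq : Matrix (Fin m) (Fin n) ℝ → ℝ) := by
  -- With target `0` and factor `-1` the residual is `H` itself, so this is a least-squares term.
  have h : IsAdmissible fun H : Matrix (Fin m) (Fin n) ℝ => frobSq (0 - (-1 : Matrix (Fin m) (Fin m) ℝ) * H) :=
    frobSq_sub_mul 0 (-1)
  simpa only [Matrix.neg_mul, Matrix.one_mul, zero_sub, neg_neg] using h

/-- Test the subgradient inequality at `x + τ • g`: the gain `τ ‖g‖²` is limited by the quadratic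
growth of `F`, since `F x ≥ 0`. -/
lemma frobSq_subgradient_le (hF : IsAdmissible F) :
    ∃ c, 0 ≤ c ∧ ∀ x g, IsSubgradient F x g → frobSq g ≤ c * (1 + frobSq x) := by
  obtain ⟨c, hc⟩ := hF.growth
  have hc0 : 0 ≤ c := by simpa [frobSq_zero] using (hF.nonneg 0).trans (hc 0)
  refine ⟨4 * c * (4 * c + 1), by positivity, fun x g hg => ?_⟩
  have key : ∀ τ : ℝ, τ * frobSq g ≤ c * (1 + 2 * frobSq x + 2 * (τ ^ 2 * frobSq g)) := by
    intro τ
    have h1 := hg (x + τ • g)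
    rw [add_sub_cancel_left, frobInner_smul_right, frobInner_self] at h1
    have h2 := frobSq_add_le x (τ • g)
    rw [frobSq_smul] at h2
    have h3 := mul_le_mul_of_nonneg_left h2 hc0
    linarith [hc (x + τ • g), hF.nonneg x]
  -- For this `τ` the term `2 c τ² ‖g‖²` is at most half of `τ ‖g‖²` and can be absorbed; the `+ 1`
  -- covers `c = 0`.
  have h := key (1 / (4 * c + 1))
  have hpos : 0 < 4 * c + 1 := by positivity
  have h2 := mul_le_mul_of_nonneg_left h (sq_nonneg (4 * c + 1))
  have e1 : (4 * c + 1) ^ 2 * (1 / (4 * c + 1) * frobSq g) = (4 * c + 1) * frobSq g := by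
    field_simp
  have e2 : (4 * c + 1) ^ 2 * (c * (1 + 2 * frobSq x + 2 * ((1 / (4 * c + 1)) ^ 2 * frobSq g)))
      = (4 * c + 1) ^ 2 * c * (1 + 2 * frobSq x) + 2 * c * frobSq g := by
    field_simp
  rw [e1, e2] at h2
  have h3 : (4 * c + 1) * frobSq g ≤ (4 * c + 1) * (4 * c * (4 * c + 1) * (1 + frobSq x)) := by
    nlinarith [frobSq_nonneg g, mul_nonneg (sq_nonneg (4 * c + 1)) hc0]
  exact le_of_mul_le_mul_left h3 hpos

end IsAdmissible

/-- Deterministic Robbins–Siegmund lemma. -/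
lemma robbinsSiegmund {u v b : ℕ → ℝ} (hu : ∀ k, 0 ≤ u k) (hv : ∀ k, 0 ≤ v k) (hb : ∀ k, 0 ≤ b k)
    (hbs : Summable b) (h : ∀ k, u (k + 1) ≤ (1 + b k) * u k + b k - v k) :
    (∃ l, Tendsto u atTop (𝓝 l)) ∧ Summable v := by
  set p : ℕ → ℝ := fun k => ∏ i ∈ Finset.range k, (1 + b i) with hp
  have hps : ∀ k, p (k + 1) = p k * (1 + b k) := fun k => Finset.prod_range_succ _ _
  have hp1 : ∀ k, 1 ≤ p k := fun k => Finset.prod_induction _ (1 ≤ ·) (fun _ _ => one_le_mul_of_one_le_of_one_le)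
    le_rfl fun i _ => by linarith [hb i]
  have hpmono : Monotone p := monotone_nat_of_le_succ fun k => by
    rw [hps]; nlinarith [hp1 k, hb k]
  have hpb : ∀ k, p k ≤ Real.exp (∑' i, b i) := fun k => by
    calc p k ≤ ∏ i ∈ Finset.range k, Real.exp (b i) :=
          Finset.prod_le_prod (fun i _ => by linarith [hb i]) fun i _ => by
            linarith [Real.add_one_le_exp (b i)]
      _ = Real.exp (∑ i ∈ Finset.range k, b i) := (Real.exp_sum _ _).symm
      _ ≤ _ := Real.exp_le_exp.2 (hbs.sum_le_tsum _ fun i _ => hb i)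
  set M := Real.exp (∑' i, b i)
  have hM : 0 < M := Real.exp_pos _
  obtain ⟨P, hP⟩ : ∃ P, Tendsto p atTop (𝓝 P) :=
    ⟨_, tendsto_atTop_ciSup hpmono ⟨M, by rintro _ ⟨k, rfl⟩; exact hpb k⟩⟩
  -- Since `(1 + b k) * u k + b k + 1 = (1 + b k) * (u k + 1)`, the shift by one and the integrating
  -- factor `p` turn the recursion into a monotone one with drop at least `v k / M`.
  set w : ℕ → ℝ := fun k => (u k + 1) / p k with hw
  have hp0 : ∀ k, 0 < p k := fun k => lt_of_lt_of_le one_pos (hp1 k)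
  have hstep : ∀ k, w (k + 1) + v k / M ≤ w k := fun k => by
    have h1 : v k / M ≤ v k / p (k + 1) := div_le_div_of_nonneg_left (hv k) (hp0 _) (hpb _)
    have h2 : w k = (1 + b k) * (u k + 1) / p (k + 1) := by
      have := hp0 k
      have := hb k
      rw [hw, hps]
      field_simp
    have h3 : w (k + 1) + v k / p (k + 1) ≤ w k := by
      rw [h2, hw, ← add_div]
      exact div_le_div_of_nonneg_right (by linarith [h k]) (hp0 _).le
    linarith
  have hw0 : ∀ k, 0 ≤ w k := fun k => div_nonneg (by linarith [hu k]) (hp0 k).le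
  have hwanti : Antitone w := antitone_nat_of_succ_le fun k => by
    linarith [hstep k, div_nonneg (hv k) hM.le]
  obtain ⟨l, hl⟩ : ∃ l, Tendsto w atTop (𝓝 l) :=
    ⟨_, tendsto_atTop_ciInf hwanti ⟨0, by rintro _ ⟨k, rfl⟩; exact hw0 k⟩⟩
  refine ⟨⟨l * P - 1, ?_⟩, ?_⟩
  · refine ((hl.mul hP).sub_const 1).congr fun k => ?_
    have := (hp0 k).ne'
    simp only [hw]
    field_simp
    ring
  · have hs : Summable fun k => v k / M := by
      refine summable_of_sum_range_le (c := w 0) (fun k => div_nonneg (hv k) hM.le) fun k => ?_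
      have : ∀ k, ∑ i ∈ Finset.range k, v i / M ≤ w 0 - w k := by
        intro k
        induction k with
        | zero => simp
        | succ k ih => rw [Finset.sum_range_succ]; linarith [hstep k]
      linarith [this k, hw0 k]
    refine (hs.mul_left M).congr fun k => ?_
    field_simp

/-! ### Convergence of projected subgradient descent. -/

section ProjectedSubgradient

variable {m n : ℕ} {F : Matrix (Fin m) (Fin n) ℝ → ℝ} {α : ℕ → ℝ}
  {h : ℕ → Matrix (Fin m) (Fin n) ℝ}

lemma IsAdmissible.exists_projectedSubgradient (hF : IsAdmissible F) (α : ℕ → ℝ)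
    (h₀ : Matrix (Fin m) (Fin n) ℝ) : ∃ h, h 0 = h₀ ∧ IsProjectedSubgradient F α h := by
  choose g hg using hF.subgradient
  exact ⟨fun k => Nat.rec h₀ (fun k x => projNonneg (x - α k • g x)) k, rfl,
    fun k => ⟨_, hg _, rfl⟩⟩

lemma IsProjectedSubgradient.succ_mem (hh : IsProjectedSubgradient F α h) (k : ℕ) :
    h (k + 1) ∈ nonnegSet m n := by
  obtain ⟨g, -, hk⟩ := hh k
  rw [hk]
  exact projNonneg_mem _

/-- Expand the square after one step, using that projection does not increase the distance to the
feasible `x`. Indices start at `1` because `h 0` may be infeasible, and then `F (h 0) - F x` could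
be negative. -/
lemma IsProjectedSubgradient.quasiFejer (hF : IsAdmissible F) (hα : IsStepSize α)
    (hh : IsProjectedSubgradient F α h) {x : Matrix (Fin m) (Fin n) ℝ}
    (hx : IsArgmin F (nonnegSet m n) x) :
    (∃ l, Tendsto (fun k => frobSq (h (k + 1) - x)) atTop (𝓝 l)) ∧
      Summable fun k => 2 * α (k + 1) * (F (h (k + 1)) - F x) := by
  obtain ⟨c, hc0, hc⟩ := hF.frobSq_subgradient_le
  have hx0 := frobSq_nonneg x
  -- The constant comes from `1 + ‖h‖² ≤ (2 + 2‖x‖²)(1 + ‖h - x‖²)`, so one sequence `b` serves as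
  -- both the multiplicative and the additive error.
  refine robbinsSiegmund (b := fun k => c * (2 + 2 * frobSq x) * α (k + 1) ^ 2)
    (fun k => frobSq_nonneg _)
    (fun k => mul_nonneg (by linarith [hα.1 (k + 1)]) (sub_nonneg.2 (hx.2 (hh.succ_mem k))))
    (fun k => by positivity) (((summable_nat_add_iff 1).2 hα.2.2).mul_left _) fun k => ?_
  obtain ⟨g, hg, hk⟩ := hh (k + 1)
  have h1 := frobSq_projNonneg_sub_le (h (k + 1) - α (k + 1) • g) hx.1
  rw [← hk, sub_right_comm, frobSq_sub (h (k + 1) - x), frobInner_smul_right, frobSq_smul] at h1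
  have h2 := hg x
  rw [← neg_sub, frobInner_neg_right, frobInner_comm] at h2
  have h3 : frobSq (h (k + 1)) ≤ 2 * frobSq (h (k + 1) - x) + 2 * frobSq x := by
    simpa using frobSq_add_le (h (k + 1) - x) x
  have h4 : frobSq g ≤ c * (2 + 2 * frobSq x) * (1 + frobSq (h (k + 1) - x)) := by
    refine (hc _ _ hg).trans ?_
    rw [mul_assoc]
    refine mul_le_mul_of_nonneg_left ?_ hc0
    nlinarith [mul_nonneg hx0 (frobSq_nonneg (h (k + 1) - x))]
  have h5 := mul_le_mul_of_nonneg_left h4 (sq_nonneg (α (k + 1)))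
  have h6 := mul_le_mul_of_nonneg_left h2 (hα.1 (k + 1)).le
  linarith

theorem IsProjectedSubgradient.tendsto_argmin (hF : IsAdmissible F) (hα : IsStepSize α)
    (hh : IsProjectedSubgradient F α h) {x : Matrix (Fin m) (Fin n) ℝ}
    (hx : IsArgmin F (nonnegSet m n) x) :
    ∃ H, IsArgmin F (nonnegSet m n) H ∧ Tendsto h atTop (𝓝 H) := by
  obtain ⟨⟨l, hl⟩, hs⟩ := hh.quasiFejer hF hα hx
  have hα1 : ¬ Summable fun k => α (k + 1) := fun h => hα.2.1 ((summable_nat_add_iff 1).1 h)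
  -- Otherwise the gap is eventually at least `ε`, and the step sizes would be dominated by a
  -- summable sequence.
  have hfreq : ∀ ε > 0, ∃ᶠ k in atTop, F (h (k + 1)) < F x + ε := by
    intro ε hε hcon
    refine hα1 ?_
    have h1 : ∀ᶠ k in atTop, ‖α (k + 1)‖ ≤ (2 * ε)⁻¹ * (2 * α (k + 1) * (F (h (k + 1)) - F x)) := by
      filter_upwards [hcon] with k hk
      rw [Real.norm_of_nonneg (hα.1 _).le]
      have := hα.1 (k + 1)
      have h2 : ε ≤ F (h (k + 1)) - F x := by linarith [not_lt.1 hk]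
      rw [inv_mul_eq_div, le_div_iff₀ (by positivity)]
      nlinarith
    exact .of_norm_bounded_eventually_nat (hs.mul_left _) h1
  obtain ⟨φ, hφ, hφF⟩ := extraction_forall_of_frequently
    (fun j : ℕ => hfreq (1 / ((j : ℝ) + 1)) (by positivity))
  obtain ⟨B, hB⟩ := hl.bddAbove_range
  obtain ⟨y, -, ψ, hψ, hy⟩ := (isCompact_entryBox m n (1 + B)).tendsto_subseq
    (x := fun j => h (φ j + 1) - x) fun j s t =>
      (abs_apply_le_one_add_frobSq _ s t).trans (by linarith [hB ⟨φ j, rfl⟩])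
  have hH : Tendsto (fun j => h (φ (ψ j) + 1)) atTop (𝓝 (y + x)) := by
    simpa [Function.comp_def] using hy.add_const x
  have hHF : F (y + x) ≤ F x := by
    have h1 : Tendsto (fun j : ℕ => F x + 1 / ((j : ℝ) + 1)) atTop (𝓝 (F x + 0)) :=
      tendsto_one_div_add_atTop_nhds_zero_nat.const_add _
    rw [add_zero] at h1
    exact le_of_tendsto_of_tendsto' ((hF.continuous.tendsto _).comp hH)
      (h1.comp hψ.tendsto_atTop) fun j => (hφF (ψ j)).le
  have harg : IsArgmin F (nonnegSet m n) (y + x) :=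
    ⟨(isClosed_nonnegSet m n).mem_of_tendsto hH (Eventually.of_forall fun j => hh.succ_mem _),
      fun z hz => hHF.trans (hx.2 hz)⟩
  refine ⟨_, harg, (tendsto_add_atTop_iff_nat 1).1 (tendsto_of_frobSq_sub ?_)⟩
  -- Recentre at the minimizer just found: the distance to it converges, and along the subsequence
  -- its limit is `0`.
  obtain ⟨⟨l', hl'⟩, -⟩ := hh.quasiFejer hF hα harg
  have h0 : Tendsto (fun j => frobSq (h (φ (ψ j) + 1) - (y + x))) atTop (𝓝 0) := by
    have := (continuous_frobSq.tendsto _).comp (hH.sub_const (y + x))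
    simpa [Function.comp_def, frobSq_zero] using this
  rwa [tendsto_nhds_unique (hl'.comp (hφ.comp hψ).tendsto_atTop) h0] at hl'

end ProjectedSubgradient

/-! ### The three penalties: subgradients and coercivity. -/

section Penalty

variable {r T : ℕ}

lemma frobInner_row (s : Fin r) (c : Fin T → ℝ) (H : Matrix (Fin r) (Fin T) ℝ) :
    frobInner (Matrix.of fun i j => if i = s then c j else 0) H = ∑ f, H s f * c f := by
  simp only [frobInner, Matrix.of_apply, ite_mul, zero_mul]
  rw [Finset.sum_comm]
  exact Finset.sum_congr rfl fun f _ => by simp [mul_comm]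

lemma dft_apply_re (H : Matrix (Fin r) (Fin T) ℝ) (s : Fin r) (k : Fin T) :
    (dft H s k).re = ∑ f, H s f * (fourierMatrix T f k).re := by
  simp [dft, Matrix.mul_apply]

lemma dft_apply_im (H : Matrix (Fin r) (Fin T) ℝ) (s : Fin r) (k : Fin T) :
    (dft H s k).im = ∑ f, H s f * (fourierMatrix T f k).im := by
  simp [dft, Matrix.mul_apply]

/-- Covers the lasso (`c` an indicator) and the real and imaginary parts of the Fourier coefficients
(`c` from a column of the Fourier matrix). -/
lemma isAdmissible_abs_row (s : Fin r) (c : Fin T → ℝ) :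
    IsAdmissible fun H : Matrix (Fin r) (Fin T) ℝ => |∑ f, H s f * c f| := by
  simpa only [frobInner_row] using
    IsAdmissible.abs_frobInner (Matrix.of fun i j => if i = s then c j else 0)

lemma Regularizer.isAdmissible_penalty (ρ : Regularizer) :
    IsAdmissible (ρ.penalty : Matrix (Fin r) (Fin T) ℝ → ℝ) := by
  cases ρ with
  | ridge => exact IsAdmissible.frobSq_self
  | lasso =>
    change IsAdmissible fun H : Matrix (Fin r) (Fin T) ℝ => ∑ s, ∑ t, |H s t|
    refine IsAdmissible.sum _ fun s _ => IsAdmissible.sum _ fun t _ => ?_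
    simpa using isAdmissible_abs_row s fun f => if f = t then (1 : ℝ) else 0
  | softFrequency =>
    change IsAdmissible fun H : Matrix (Fin r) (Fin T) ℝ =>
      ∑ s, ∑ k, (|(dft H s k).re| + |(dft H s k).im|)
    refine IsAdmissible.sum _ fun s _ => IsAdmissible.sum _ fun k _ => ?_
    simp only [dft_apply_re, dft_apply_im]
    exact (isAdmissible_abs_row s _).add (isAdmissible_abs_row s _)

/-- Orthogonality of the columns of the Fourier matrix. -/
lemma sum_fourierMatrix_mul_exp (f g : Fin T) :
    ∑ k : Fin T, fourierMatrix T f k *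
      Complex.exp (2 * (Real.pi : ℂ) * Complex.I * ((g : ℕ) : ℂ) * ((k : ℕ) : ℂ) / (T : ℂ)) =
      if f = g then 1 else 0 := by
  have hT : T ≠ 0 := fun h => by subst h; exact f.elim0
  have hT' : (T : ℂ) ≠ 0 := Nat.cast_ne_zero.2 hT
  set ζ : ℂ := Complex.exp (2 * (Real.pi : ℂ) * Complex.I / (T : ℂ)) with hζ
  have hprim : IsPrimitiveRoot ζ T := Complex.isPrimitiveRoot_exp T hT
  have hζ0 : ζ ≠ 0 := Complex.exp_ne_zero _
  -- The sum is geometric in `q`, a `T`-th root of unity that equals `1` only for `f = g`.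
  set q : ℂ := ζ ^ (g : ℕ) / ζ ^ (f : ℕ) with hq
  have hterm : ∀ k : Fin T, fourierMatrix T f k *
      Complex.exp (2 * (Real.pi : ℂ) * Complex.I * ((g : ℕ) : ℂ) * ((k : ℕ) : ℂ) / (T : ℂ)) =
      q ^ (k : ℕ) / T := by
    intro k
    rw [hq, div_pow, hζ]
    simp only [← Complex.exp_nat_mul, ← Complex.exp_sub, fourierMatrix, Matrix.of_apply]
    rw [div_mul_eq_mul_div, ← Complex.exp_add]
    congr 2
    ring
  simp only [hterm]
  rw [← Finset.sum_div, Fin.sum_univ_eq_sum_range (fun k => q ^ k) T]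
  split_ifs with hfg
  · subst hfg
    rw [hq, div_self (pow_ne_zero _ hζ0)]
    simp [hT']
  · have hq1 : q ≠ 1 := fun h => hfg <| by
      rw [hq, div_eq_one_iff_eq (pow_ne_zero _ hζ0)] at h
      exact Fin.ext (hprim.pow_inj g.2 f.2 h).symm
    have hqT : q ^ T = 1 := by
      rw [hq, div_pow, ← pow_mul, ← pow_mul, mul_comm, pow_mul, mul_comm (f : ℕ), pow_mul,
        hprim.pow_eq_one]
      simp
    rw [geom_sum_eq hq1, hqT]
    simp

/-- Fourier inversion has unimodular coefficients, the factor `1 / T` being in the forward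
transform. This makes the soft frequency penalty coercive. -/
lemma abs_apply_le_sum_dft (H : Matrix (Fin r) (Fin T) ℝ) (s : Fin r) (g : Fin T) :
    |H s g| ≤ ∑ k, (|(dft H s k).re| + |(dft H s k).im|) := by
  have hinv : ∑ k : Fin T, dft H s k *
      Complex.exp (2 * (Real.pi : ℂ) * Complex.I * ((g : ℕ) : ℂ) * ((k : ℕ) : ℂ) / (T : ℂ)) =
      (H s g : ℂ) := by
    simp only [dft, Matrix.mul_apply, Finset.sum_mul, Matrix.map_apply, mul_assoc (H s _ : ℂ)]
    rw [Finset.sum_comm]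
    simp only [← Finset.mul_sum, sum_fourierMatrix_mul_exp]
    simp
  have hnorm : ∀ k : Fin T, ‖Complex.exp
      (2 * (Real.pi : ℂ) * Complex.I * ((g : ℕ) : ℂ) * ((k : ℕ) : ℂ) / (T : ℂ))‖ = 1 := by
    intro k
    have e : 2 * (Real.pi : ℂ) * Complex.I * ((g : ℕ) : ℂ) * ((k : ℕ) : ℂ) / (T : ℂ) =
        ((2 * Real.pi * (g : ℕ) * (k : ℕ) / T : ℝ) : ℂ) * Complex.I := by
      push_cast
      ring
    rw [e, Complex.norm_exp_ofReal_mul_I]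
  rw [← Real.norm_eq_abs, ← Complex.norm_real, ← hinv]
  refine (norm_sum_le _ _).trans (Finset.sum_le_sum fun k _ => ?_)
  rw [norm_mul, hnorm, mul_one]
  exact Complex.norm_le_abs_re_add_abs_im _

lemma Regularizer.abs_apply_le_one_add_penalty (ρ : Regularizer) (H : Matrix (Fin r) (Fin T) ℝ)
    (s : Fin r) (t : Fin T) : |H s t| ≤ 1 + ρ.penalty H := by
  cases ρ with
  | ridge => exact abs_apply_le_one_add_frobSq H s t
  | lasso =>
    have h1 := Finset.single_le_sum (f := fun t => |H s t|) (fun _ _ => abs_nonneg _)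
      (Finset.mem_univ t)
    have h2 := Finset.single_le_sum (f := fun s => ∑ t, |H s t|)
      (fun _ _ => Finset.sum_nonneg fun _ _ => abs_nonneg _) (Finset.mem_univ s)
    exact (h1.trans h2).trans (le_add_of_nonneg_left zero_le_one)
  | softFrequency =>
    have h2 := Finset.single_le_sum
      (f := fun s => ∑ k, (|(dft H s k).re| + |(dft H s k).im|))
      (fun _ _ => Finset.sum_nonneg fun _ _ => by positivity) (Finset.mem_univ s)
    exact ((abs_apply_le_sum_dft H s t).trans h2).trans (le_add_of_nonneg_left zero_le_one)

end Penalty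

/-! ### Solvability of the block subproblems. -/

section Subproblems

variable {d r T : ℕ}

/-- Nonnegative least squares problems have solutions. -/
lemma exists_isArgmin_leastSquares (X Y : Matrix (Fin d) (Fin T) ℝ)
    (W W' : Matrix (Fin d) (Fin r) ℝ) {ξ : ℝ} (hξ : 0 ≤ ξ) :
    ∃ H, IsArgmin (fun H : Matrix (Fin r) (Fin T) ℝ =>
      frobSq (X - W * H) + ξ * frobSq (Y - W' * H)) (nonnegSet r T) H := by
  set F : Matrix (Fin r) (Fin T) ℝ → ℝ := fun H =>
    frobSq (X - W * H) + ξ * frobSq (Y - W' * H) with hF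
  have hadm : IsAdmissible F :=
    (IsAdmissible.frobSq_sub_mul X W).add ((IsAdmissible.frobSq_sub_mul Y W').const_mul hξ)
  -- The purely quadratic part of `F`; its zeros are the directions along which `F` is constant.
  set q : Matrix (Fin r) (Fin T) ℝ → ℝ := fun H => frobSq (W * H) + ξ * frobSq (W' * H) with hq
  have hqc : Continuous q :=
    (continuous_frobSq.comp (continuous_const.matrix_mul continuous_id)).add
      (continuous_const.mul (continuous_frobSq.comp (continuous_const.matrix_mul continuous_id)))
  have hqF : ∀ H, q H ≤ 2 * F H + 2 * F 0 := fun H => by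
    have h1 := frobSq_sub_le X (X - W * H)
    have h2 := mul_le_mul_of_nonneg_left (frobSq_sub_le Y (Y - W' * H)) hξ
    simp only [sub_sub_cancel] at h1 h2
    simp only [hq, hF, Matrix.mul_zero, sub_zero]
    linarith
  have hqs : ∀ (c : ℝ) H, q (c • H) = c ^ 2 * q H := fun c H => by
    simp only [hq, Matrix.mul_smul, frobSq_smul]
    ring
  have hq0 : ∀ H D, q D = 0 → F (H - D) = F H := fun H D hD => by
    have h1 : frobSq (W * D) = 0 := by
      have := frobSq_nonneg (W * D)
      have := mul_nonneg hξ (frobSq_nonneg (W' * D))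
      simp only [hq] at hD
      linarith
    have h2 : ξ * frobSq (W' * D) = 0 := by
      simp only [hq] at hD
      linarith
    simp only [hF]
    rw [Matrix.mul_sub, Matrix.mul_sub, eq_zero_of_frobSq_eq_zero h1, sub_zero]
    rcases mul_eq_zero.1 h2 with h | h
    · simp [h]
    · rw [eq_zero_of_frobSq_eq_zero h, sub_zero]
  -- On nonnegative matrices `σ` is the `ℓ¹` norm, yet it is linear, so subtracting `D` lowers it by
  -- exactly `σ D`.
  set σ : Matrix (Fin r) (Fin T) ℝ → ℝ := fun H => ∑ s, ∑ t, H s t with hσ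
  have hσc : Continuous σ := continuous_finsetSum _ fun i _ => continuous_finsetSum _ fun j _ =>
    continuous_id.matrix_elem i j
  have hσsub : ∀ A B, σ (A - B) = σ A - σ B := fun A B => by
    simp only [hσ, Matrix.sub_apply, Finset.sum_sub_distrib]
  have hσsmul : ∀ (c : ℝ) A, σ (c • A) = c * σ A := fun c A => by
    simp only [hσ, Matrix.smul_apply, smul_eq_mul, Finset.mul_sum]
  have hbox : ∀ H ∈ nonnegSet r T, ∀ R, σ H ≤ R → H ∈ entryBox r T R := by
    intro H hH R hR s t
    rw [abs_of_nonneg (hH s t)]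
    have h1 := Finset.single_le_sum (f := fun t => H s t) (fun t _ => hH s t) (Finset.mem_univ t)
    have h2 := Finset.single_le_sum (f := fun s => ∑ t, H s t)
      (fun s _ => Finset.sum_nonneg fun t _ => hH s t) (Finset.mem_univ s)
    exact (h1.trans h2).trans hR
  have hclosed := isClosed_nonnegSet r T
  obtain ⟨R, hR⟩ : ∃ R : ℕ, ∀ H ∈ nonnegSet r T, F H ≤ F 0 →
      ∃ H' ∈ nonnegSet r T, σ H' ≤ R ∧ F H' ≤ F H := by
    by_contra hcon
    push Not at hcon
    choose H₀ hH₀ hH₀F hH₀R using hcon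
    -- If no bound worked, take a `σ`-smallest point of each sublevel set. The normalized points
    -- accumulate at some `D` with `σ D = 1` and `q D = 0`; subtracting `D` keeps `F` and will
    -- contradict minimality of `σ`.
    have hmin : ∀ n, ∃ H, IsArgmin σ (nonnegSet r T ∩ {H | F H ≤ F (H₀ n)}) H := fun n =>
      exists_isArgmin_of_sublevel_subset hσc
        (hclosed.inter (isClosed_le hadm.continuous continuous_const))
        (isCompact_entryBox r T (σ (H₀ n))) (x₀ := H₀ n) ⟨hH₀ n, le_refl (F (H₀ n))⟩
        fun H hH hle => hbox H hH.1 _ hle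
    choose H hH using hmin
    have hHn : ∀ n, H n ∈ nonnegSet r T := fun n => (hH n).1.1
    have hHF : ∀ n, F (H n) ≤ F (H₀ n) := fun n => (hH n).1.2
    have hσn : ∀ n : ℕ, (n : ℝ) < σ (H n) := fun n => by
      by_contra h
      exact absurd (hHF n) (not_le.2 (hH₀R n _ (hHn n) (not_lt.1 h)))
    have hσpos : ∀ n, 0 < σ (H n) := fun n => lt_of_le_of_lt (Nat.cast_nonneg n) (hσn n)
    have hσtop : Tendsto (fun n => σ (H n)) atTop atTop :=
      tendsto_atTop_mono (fun n => (hσn n).le) tendsto_natCast_atTop_atTop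
    have hDn : ∀ n, (σ (H n))⁻¹ • H n ∈ nonnegSet r T := fun n s t =>
      mul_nonneg (inv_nonneg.2 (hσpos n).le) (hHn n s t)
    have hDσ : ∀ n, σ ((σ (H n))⁻¹ • H n) = 1 := fun n => by
      rw [hσsmul, inv_mul_cancel₀ (hσpos n).ne']
    obtain ⟨D, -, φ, hφ, hD⟩ := (isCompact_entryBox r T 1).tendsto_subseq
      fun n => hbox _ (hDn n) 1 (hDσ n).le
    have hDnn : D ∈ nonnegSet r T := hclosed.mem_of_tendsto hD (Eventually.of_forall fun n => hDn _)
    have hD1 : σ D = 1 := by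
      refine tendsto_nhds_unique ((hσc.tendsto D).comp hD) ?_
      simp only [Function.comp_def, hDσ]
      exact tendsto_const_nhds
    have hσφ : Tendsto (fun n => σ (H (φ n))) atTop atTop := hσtop.comp hφ.tendsto_atTop
    have hqD : q D = 0 := by
      refine tendsto_nhds_unique ((hqc.tendsto D).comp hD) ?_
      have hlim : Tendsto (fun n => (σ (H (φ n)))⁻¹ ^ 2 * (4 * F 0)) atTop (𝓝 0) := by
        simpa using ((tendsto_inv_atTop_zero.comp hσφ).pow 2).mul_const (4 * F 0)
      refine squeeze_zero (fun n => ?_) (fun n => ?_) hlim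
      · exact add_nonneg (frobSq_nonneg _) (mul_nonneg hξ (frobSq_nonneg _))
      · simp only [Function.comp_def, hqs]
        refine mul_le_mul_of_nonneg_left ?_ (sq_nonneg _)
        linarith [hqF (H (φ n)), hHF (φ n), hH₀F (φ n)]
    -- Where `D` vanishes nothing is subtracted; where `D` is positive the entries of `H (φ n)` tend
    -- to infinity.
    have hev : ∀ s t, ∀ᶠ n in atTop, 0 ≤ (H (φ n) - D) s t := by
      intro s t
      rcases (hDnn s t).eq_or_lt with h0 | h0
      · exact Eventually.of_forall fun n => by
          rw [Matrix.sub_apply, ← h0, sub_zero]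
          exact hHn _ s t
      · have h1 := (tendsto_apply hD s t).pos_mul_atTop h0 hσφ
        filter_upwards [h1.eventually_ge_atTop (D s t)] with n hn
        have := (hσpos (φ n)).ne'
        simp only [Function.comp_def, Matrix.smul_apply, smul_eq_mul] at hn
        rw [mul_right_comm, inv_mul_cancel₀ this, one_mul] at hn
        rw [Matrix.sub_apply]
        linarith
    obtain ⟨n, hn⟩ := (eventually_all.2 fun s => eventually_all.2 fun t => hev s t).exists
    have hmem : H (φ n) - D ∈ nonnegSet r T ∩ {A | F A ≤ F (H₀ (φ n))} :=
      ⟨hn, (hq0 _ _ hqD).le.trans (hHF _)⟩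
    have hle : σ (H (φ n)) ≤ σ (H (φ n) - D) := (hH (φ n)).2 hmem
    rw [hσsub, hD1] at hle
    linarith
  obtain ⟨H₁, hH₁, hH₁R, -⟩ := hR 0 (zero_mem_nonnegSet r T) le_rfl
  obtain ⟨H, hH⟩ := exists_isArgmin_of_sublevel_subset hadm.continuous
    (hclosed.inter (isClosed_le hσc continuous_const)) (isCompact_entryBox r T R)
    (C := nonnegSet r T ∩ {H | σ H ≤ R}) (x₀ := H₁) ⟨hH₁, hH₁R⟩
    fun A hA _ => hbox A hA.1 _ hA.2
  have hbest : ∀ A ∈ nonnegSet r T, F A ≤ F 0 → F H ≤ F A := fun A hA hA0 => by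
    obtain ⟨B, hB, hBR, hBF⟩ := hR A hA hA0
    exact (hH.2 ⟨hB, hBR⟩ : F H ≤ F B).trans hBF
  refine ⟨H, hH.1.1, fun A hA => ?_⟩
  rcases le_total (F A) (F 0) with h | h
  · exact hbest A hA h
  · exact (hbest 0 (zero_mem_nonnegSet r T) le_rfl).trans h

lemma Problem.isAdmissible_objH (P : Problem d r T) (hxi : 0 ≤ P.xi) (hlam : 0 ≤ P.lam)
    (W W' : Matrix (Fin d) (Fin r) ℝ) : IsAdmissible (P.objH W W') :=
  ((IsAdmissible.frobSq_sub_mul P.X W).add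
    ((IsAdmissible.frobSq_sub_mul P.Y W').const_mul hxi)).add
    (P.reg.isAdmissible_penalty.const_mul hlam)

lemma Problem.exists_isArgmin_objH (P : Problem d r T) (hxi : 0 ≤ P.xi) (hlam : 0 ≤ P.lam)
    (W W' : Matrix (Fin d) (Fin r) ℝ) : ∃ H, IsArgmin (P.objH W W') (nonnegSet r T) H := by
  rcases hlam.eq_or_lt with h0 | h0
  · have e : P.objH W W' = fun H => frobSq (P.X - W * H) + P.xi * frobSq (P.Y - W' * H) := by
      funext H
      simp [Problem.objH, ← h0]
    rw [e]
    exact exists_isArgmin_leastSquares P.X P.Y W W' hxi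
  · refine exists_isArgmin_of_sublevel_subset (P.isAdmissible_objH hxi hlam W W').continuous
      (isClosed_nonnegSet r T)
      (isCompact_entryBox r T (1 + P.objH W W' 0 / P.lam)) (zero_mem_nonnegSet r T)
      fun H _ hle s t => (P.reg.abs_apply_le_one_add_penalty H s t).trans ?_
    have h1 : P.lam * P.reg.penalty H ≤ P.objH W W' H :=
      le_add_of_nonneg_left (add_nonneg (frobSq_nonneg _) (mul_nonneg hxi (frobSq_nonneg _)))
    have h2 : P.reg.penalty H ≤ P.objH W W' 0 / P.lam := by
      rw [le_div_iff₀ h0]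
      linarith
    linarith

lemma exists_isArgmin_ridge (X : Matrix (Fin d) (Fin T) ℝ) (H : Matrix (Fin r) (Fin T) ℝ)
    {a b : ℝ} (ha : 0 ≤ a) (hb : 0 < b) :
    ∃ W, IsArgmin (fun W : Matrix (Fin d) (Fin r) ℝ => a * frobSq (X - W * H) + b * frobSq W)
      Set.univ W := by
  set F : Matrix (Fin d) (Fin r) ℝ → ℝ := fun W => a * frobSq (X - W * H) + b * frobSq W with hF
  have hc : Continuous F := (continuous_const.mul (continuous_frobSq.comp
    (continuous_const.sub (continuous_id.matrix_mul continuous_const)))).add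
    (continuous_const.mul continuous_frobSq)
  refine exists_isArgmin_of_sublevel_subset hc isClosed_univ
    (isCompact_entryBox d r (1 + F 0 / b)) (Set.mem_univ 0)
    fun W _ hle s t => (abs_apply_le_one_add_frobSq W s t).trans ?_
  have h1 : b * frobSq W ≤ F W := le_add_of_nonneg_left (mul_nonneg ha (frobSq_nonneg _))
  have h2 : frobSq W ≤ F 0 / b := by
    rw [le_div_iff₀ hb]
    linarith
  linarith

/-- Compare `W` with the midpoint of `V` and `W`: the parallelogram identity yields the strong
convexity estimate without derivatives. -/
lemma frobSq_sub_le_of_isArgmin_ridge {X : Matrix (Fin d) (Fin T) ℝ}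
    {H : Matrix (Fin r) (Fin T) ℝ} {a b : ℝ} (ha : 0 ≤ a) {W : Matrix (Fin d) (Fin r) ℝ}
    (hW : IsArgmin (fun W : Matrix (Fin d) (Fin r) ℝ => a * frobSq (X - W * H) + b * frobSq W)
      Set.univ W) (V : Matrix (Fin d) (Fin r) ℝ) :
    b / 2 * frobSq (V - W) ≤ (a * frobSq (X - V * H) + b * frobSq V) -
      (a * frobSq (X - W * H) + b * frobSq W) := by
  have h1 : a * frobSq (X - W * H) + b * frobSq W ≤
      a * frobSq (X - ((1 / 2 : ℝ) • (V + W)) * H) + b * frobSq ((1 / 2 : ℝ) • (V + W)) :=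
    hW.2 (Set.mem_univ _)
  have e : X - ((1 / 2 : ℝ) • (V + W)) * H = (1 / 2 : ℝ) • ((X - V * H) + (X - W * H)) := by
    rw [Matrix.smul_mul, Matrix.add_mul]
    module
  rw [e, frobSq_midpoint, frobSq_midpoint] at h1
  nlinarith [mul_nonneg ha (frobSq_nonneg ((X - V * H) - (X - W * H)))]

end Subproblems

/-! ### Block coordinate descent: stationarity and compactness. -/

section BlockCoordinateDescent

variable {d r T : ℕ}

/-- The mixed second difference of `(W, H) ↦ ‖X - W H‖²` along a line is quadratically small. -/
lemma exists_mixed_difference_eq (X : Matrix (Fin d) (Fin T) ℝ) (W B : Matrix (Fin d) (Fin r) ℝ)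
    (H A : Matrix (Fin r) (Fin T) ℝ) : ∃ p : ℝ → ℝ, Continuous p ∧ ∀ t : ℝ,
      frobSq (X - (W + t • B) * (H + t • A)) - frobSq (X - W * (H + t • A)) -
        frobSq (X - (W + t • B) * H) + frobSq (X - W * H) = t ^ 2 * p t := by
  refine ⟨fun t => ∑ i, ∑ j, (2 * (W * A) i j * (B * H) i j - 2 * (X - W * H) i j * (B * A) i j +
    2 * t * ((W * A) i j + (B * H) i j) * (B * A) i j + t ^ 2 * (B * A) i j ^ 2),
    by fun_prop, fun t => ?_⟩
  have e1 : X - (W + t • B) * (H + t • A) =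
      X - W * H - t • (W * A) - t • (B * H) - t ^ 2 • (B * A) := by
    simp only [Matrix.add_mul, Matrix.mul_add, Matrix.smul_mul, Matrix.mul_smul]
    module
  have e2 : X - W * (H + t • A) = X - W * H - t • (W * A) := by
    simp only [Matrix.mul_add, Matrix.mul_smul]
    module
  have e3 : X - (W + t • B) * H = X - W * H - t • (B * H) := by
    simp only [Matrix.add_mul, Matrix.smul_mul]
    module
  rw [e1, e2, e3]
  generalize X - W * H = R
  simp only [frobSq, Finset.mul_sum, ← Finset.sum_add_distrib, ← Finset.sum_sub_distrib,
    Matrix.sub_apply, Matrix.smul_apply, smul_eq_mul]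
  exact Finset.sum_congr rfl fun _ _ => Finset.sum_congr rfl fun _ _ => by ring

namespace Problem

variable (P : Problem d r T)

lemma objective_eq_objH (H : Matrix (Fin r) (Fin T) ℝ) (W W' : Matrix (Fin d) (Fin r) ℝ) :
    P.objective (H, W, W') = P.objH W W' H + P.lam₁ * frobSq W + P.lam₂ * frobSq W' := rfl

lemma objective_eq_objW (H : Matrix (Fin r) (Fin T) ℝ) (W W' : Matrix (Fin d) (Fin r) ℝ) :
    P.objective (H, W, W') = P.objW H W + P.objW' H W' + P.lam * P.reg.penalty H := by
  simp only [objective, objW, objW']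
  ring

lemma continuous_objective : Continuous P.objective := by
  have hp : Continuous fun z : Triple d r T => P.reg.penalty z.1 :=
    P.reg.isAdmissible_penalty.continuous.comp continuous_fst
  have hW : Continuous fun z : Triple d r T => frobSq (P.X - z.2.1 * z.1) :=
    continuous_frobSq.comp (continuous_const.sub
      ((continuous_fst.comp continuous_snd).matrix_mul continuous_fst))
  have hW' : Continuous fun z : Triple d r T => frobSq (P.Y - z.2.2 * z.1) :=
    continuous_frobSq.comp (continuous_const.sub
      ((continuous_snd.comp continuous_snd).matrix_mul continuous_fst))
  exact ((((hW.add (continuous_const.mul hW')).add (continuous_const.mul hp)).add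
    (continuous_const.mul (continuous_frobSq.comp (continuous_fst.comp continuous_snd)))).add
    (continuous_const.mul (continuous_frobSq.comp (continuous_snd.comp continuous_snd))))

lemma objective_nonneg (hxi : 0 ≤ P.xi) (hlam : 0 ≤ P.lam) (hlam₁ : 0 < P.lam₁)
    (hlam₂ : 0 < P.lam₂) (z : Triple d r T) : 0 ≤ P.objective z :=
  add_nonneg (add_nonneg ((P.isAdmissible_objH hxi hlam z.2.1 z.2.2).nonneg z.1)
    (mul_nonneg hlam₁.le (frobSq_nonneg _))) (mul_nonneg hlam₂.le (frobSq_nonneg _))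

lemma isArgmin_objW_iff {H : Matrix (Fin r) (Fin T) ℝ} {W : Matrix (Fin d) (Fin r) ℝ} :
    IsArgmin (P.objW H) Set.univ W ↔ IsArgmin (fun W : Matrix (Fin d) (Fin r) ℝ =>
      1 * frobSq (P.X - W * H) + P.lam₁ * frobSq W) Set.univ W := by
  have e : P.objW H = fun W : Matrix (Fin d) (Fin r) ℝ =>
      1 * frobSq (P.X - W * H) + P.lam₁ * frobSq W := by
    funext W
    rw [one_mul, objW]
  rw [e]

lemma exists_isBCD (hxi : 0 ≤ P.xi) (hlam : 0 ≤ P.lam) (hlam₁ : 0 < P.lam₁) (hlam₂ : 0 < P.lam₂)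
    (z₀ : Triple d r T) : ∃ z : ℕ → Triple d r T, z 0 = z₀ ∧ P.IsBCD z := by
  choose h hh using P.exists_isArgmin_objH hxi hlam
  have hW : ∀ H, ∃ W, IsArgmin (P.objW H) Set.univ W := fun H =>
    (exists_isArgmin_ridge P.X H zero_le_one hlam₁).imp fun _ => P.isArgmin_objW_iff.2
  have hW' : ∀ H, ∃ W', IsArgmin (P.objW' H) Set.univ W' := fun H =>
    exists_isArgmin_ridge P.Y H hxi hlam₂
  choose w hw using hW
  choose w' hw' using hW'
  set step : Triple d r T → Triple d r T := fun x =>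
    (h x.2.1 x.2.2, w (h x.2.1 x.2.2), w' (h x.2.1 x.2.2))
  have hs : ∀ j, step^[j + 1] z₀ = step (step^[j] z₀) := fun j =>
    Function.iterate_succ_apply' step j z₀
  refine ⟨fun j => step^[j] z₀, rfl, fun j => ?_, fun j => ?_, fun j => ?_⟩
  · rw [hs]
    exact hh (step^[j] z₀).2.1 (step^[j] z₀).2.2
  · rw [hs]
    exact hw (step (step^[j] z₀)).1
  · rw [hs]
    exact hw' (step (step^[j] z₀)).1

/-- Points that are minimal in each block are stationary. -/
lemma mem_stationarySet_of_isArgmin {H : Matrix (Fin r) (Fin T) ℝ}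
    {W W' : Matrix (Fin d) (Fin r) ℝ} (hH : IsArgmin (P.objH W W') (nonnegSet r T) H)
    (hW : IsArgmin (P.objW H) Set.univ W) (hW' : IsArgmin (P.objW' H) Set.univ W') :
    (H, W, W') ∈ P.stationarySet := by
  refine ⟨hH.1, fun y hy ε hε => ?_⟩
  obtain ⟨H₁, W₁, W₁'⟩ := y
  obtain ⟨p, hpc, hp⟩ := exists_mixed_difference_eq P.X W (W₁ - W) H (H₁ - H)
  obtain ⟨p', hpc', hp'⟩ := exists_mixed_difference_eq P.Y W' (W₁' - W') H (H₁ - H)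
  -- By minimality in each block, the increment of the objective is at least the sum of the two
  -- mixed differences, `t² (p t + ξ p' t)`. After division by `t` this bound tends to `0`.
  have hlim : Tendsto (fun t => t * (p t + P.xi * p' t)) (𝓝[>] 0) (𝓝 0) := by
    have hc : Continuous fun t => t * (p t + P.xi * p' t) := by fun_prop
    have := hc.tendsto 0
    rw [zero_mul] at this
    exact this.mono_left nhdsWithin_le_nhds
  filter_upwards [hlim.eventually_const_le (neg_lt_zero.2 hε), self_mem_nhdsWithin,
    Ioo_mem_nhdsGT zero_lt_one] with t ht ht0 ht1
  have ht0 : 0 < t := ht0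
  rw [le_div_iff₀ ht0]
  have hmem : H + t • (H₁ - H) ∈ nonnegSet r T := fun i j => by
    have h1 : 0 ≤ H i j := hH.1 i j
    have h2 : 0 ≤ H₁ i j := hy i j
    simp only [Matrix.add_apply, Matrix.smul_apply, Matrix.sub_apply, smul_eq_mul]
    nlinarith [mul_nonneg ht0.le h2, mul_nonneg (sub_nonneg.2 ht1.2.le) h1]
  have hHt : P.objH W W' H ≤ P.objH W W' (H + t • (H₁ - H)) := hH.2 hmem
  have hWt : P.objW H W ≤ P.objW H (W + t • (W₁ - W)) := hW.2 (Set.mem_univ _)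
  have hWt' : P.objW' H W' ≤ P.objW' H (W' + t • (W₁' - W')) := hW'.2 (Set.mem_univ _)
  have e : (H, W, W') + t • ((H₁, W₁, W₁') - (H, W, W')) =
      (H + t • (H₁ - H), W + t • (W₁ - W), W' + t • (W₁' - W')) := rfl
  rw [e]
  simp only [objH, objW, objW', objective] at *
  have h3 := mul_le_mul_of_nonneg_right ht ht0.le
  have h4 := congrArg (P.xi * ·) (hp' t)
  have h5 := hp t
  beta_reduce at h4
  linarith

namespace IsBCD

variable {P} {z : ℕ → Triple d r T}

/-- The descent starts at index `1`: comparing with the previous `H` requires it to be nonnegative,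
which may fail for the initialization. -/
lemma objective_succ_add_le (hz : P.IsBCD z) (hxi : 0 ≤ P.xi) (j : ℕ) :
    P.objective (z (j + 2)) + P.lam₁ / 2 * frobSq ((z (j + 1)).2.1 - (z (j + 2)).2.1) +
      P.lam₂ / 2 * frobSq ((z (j + 1)).2.2 - (z (j + 2)).2.2) ≤ P.objective (z (j + 1)) := by
  have hH : P.objH (z (j + 1)).2.1 (z (j + 1)).2.2 (z (j + 2)).1 ≤
      P.objH (z (j + 1)).2.1 (z (j + 1)).2.2 (z (j + 1)).1 := (hz.stepH (j + 1)).2 (hz.stepH j).1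
  have hW := frobSq_sub_le_of_isArgmin_ridge zero_le_one
    (P.isArgmin_objW_iff.1 (hz.stepW (j + 1))) (z (j + 1)).2.1
  have hW' := frobSq_sub_le_of_isArgmin_ridge hxi (hz.stepW' (j + 1)) (z (j + 1)).2.2
  simp only [objH, objective, add_assoc, one_add_one_eq_two] at *
  linarith

lemma antitone_objective (hz : P.IsBCD z) (hxi : 0 ≤ P.xi) (hlam₁ : 0 < P.lam₁)
    (hlam₂ : 0 < P.lam₂) : Antitone fun j => P.objective (z (j + 1)) :=
  antitone_nat_of_succ_le fun j => by
    have h1 := mul_nonneg (half_pos hlam₁).le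
      (frobSq_nonneg ((z (j + 1)).2.1 - (z (j + 2)).2.1))
    have h2 := mul_nonneg (half_pos hlam₂).le
      (frobSq_nonneg ((z (j + 1)).2.2 - (z (j + 2)).2.2))
    have h3 := hz.objective_succ_add_le hxi j
    change P.objective (z (j + 2)) ≤ _
    linarith

/-- No analogue for `H` is needed: `H` is updated first, so only `W` and `W'` enter a later
condition with outdated values. -/
lemma tendsto_sub (hz : P.IsBCD z) (hxi : 0 ≤ P.xi) (hlam : 0 ≤ P.lam) (hlam₁ : 0 < P.lam₁)
    (hlam₂ : 0 < P.lam₂) :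
    Tendsto (fun j => (z j).2.1 - (z (j + 1)).2.1) atTop (𝓝 0) ∧
      Tendsto (fun j => (z j).2.2 - (z (j + 1)).2.2) atTop (𝓝 0) := by
  obtain ⟨l, hl⟩ : ∃ l, Tendsto (fun j => P.objective (z (j + 1))) atTop (𝓝 l) :=
    ⟨_, tendsto_atTop_ciInf (hz.antitone_objective hxi hlam₁ hlam₂)
      ⟨0, by rintro _ ⟨k, rfl⟩; exact P.objective_nonneg hxi hlam hlam₁ hlam₂ _⟩⟩
  have hd : Tendsto (fun j => P.objective (z (j + 1)) - P.objective (z (j + 2))) atTop (𝓝 0) := by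
    simpa using hl.sub (hl.comp (tendsto_add_atTop_nat 1))
  have hbound : ∀ j, P.lam₁ / 2 * frobSq ((z (j + 1)).2.1 - (z (j + 2)).2.1) +
      P.lam₂ / 2 * frobSq ((z (j + 1)).2.2 - (z (j + 2)).2.2) ≤
      P.objective (z (j + 1)) - P.objective (z (j + 2)) := fun j => by
    linarith [hz.objective_succ_add_le hxi j]
  constructor
  · refine (tendsto_add_atTop_iff_nat 1).1 (tendsto_zero_of_frobSq ?_)
    have hd1 := hd.div_const (P.lam₁ / 2)
    rw [zero_div] at hd1
    refine squeeze_zero (fun j => frobSq_nonneg _) (fun j => ?_) hd1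
    rw [le_div_iff₀ (half_pos hlam₁)]
    have := mul_nonneg (half_pos hlam₂).le
      (frobSq_nonneg ((z (j + 1)).2.2 - (z (j + 2)).2.2))
    linarith [hbound j]
  · refine (tendsto_add_atTop_iff_nat 1).1 (tendsto_zero_of_frobSq ?_)
    have hd1 := hd.div_const (P.lam₂ / 2)
    rw [zero_div] at hd1
    refine squeeze_zero (fun j => frobSq_nonneg _) (fun j => ?_) hd1
    rw [le_div_iff₀ (half_pos hlam₂)]
    have := mul_nonneg (half_pos hlam₁).le
      (frobSq_nonneg ((z (j + 1)).2.1 - (z (j + 2)).2.1))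
    linarith [hbound j]

theorem mem_stationarySet (hz : P.IsBCD z) (hxi : 0 ≤ P.xi) (hlam : 0 ≤ P.lam)
    (hlam₁ : 0 < P.lam₁) (hlam₂ : 0 < P.lam₂) {z' : Triple d r T}
    (hz' : MapClusterPt z' atTop z) : z' ∈ P.stationarySet := by
  obtain ⟨φ, hφ, hlim⟩ := hz'.tendsto_subseq
  obtain ⟨H, W, W'⟩ := z'
  obtain ⟨hd, hd'⟩ := hz.tendsto_sub hxi hlam hlam₁ hlam₂
  -- Predecessor indices; using `φ (n + 1) ≥ 1` keeps the truncated subtraction exact.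
  set χ : ℕ → ℕ := fun n => φ (n + 1) - 1 with hχ
  have hχs : ∀ n, χ n + 1 = φ (n + 1) := fun n =>
    Nat.sub_add_cancel ((Nat.succ_pos n).trans_le (hφ.id_le (n + 1)))
  have hχt : Tendsto χ atTop atTop :=
    tendsto_atTop_mono (fun n => Nat.le_sub_one_of_lt (hφ.id_le (n + 1))) tendsto_id
  have hs : Tendsto (fun n => z (χ n + 1)) atTop (𝓝 (H, W, W')) := by
    simp only [hχs]
    exact hlim.comp (tendsto_add_atTop_nat 1)
  have hsH : Tendsto (fun n => (z (χ n + 1)).1) atTop (𝓝 H) :=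
    (continuous_fst.tendsto _).comp hs
  have hsW : Tendsto (fun n => (z (χ n + 1)).2.1) atTop (𝓝 W) :=
    ((continuous_fst.comp continuous_snd).tendsto _).comp hs
  have hsW' : Tendsto (fun n => (z (χ n + 1)).2.2) atTop (𝓝 W') :=
    ((continuous_snd.comp continuous_snd).tendsto _).comp hs
  have hpW : Tendsto (fun n => (z (χ n)).2.1) atTop (𝓝 W) := by
    simpa [Function.comp_def] using (hd.comp hχt).add hsW
  have hpW' : Tendsto (fun n => (z (χ n)).2.2) atTop (𝓝 W') := by
    simpa [Function.comp_def] using (hd'.comp hχt).add hsW'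
  -- Each subproblem differs from the full objective by terms constant in its block, so joint
  -- continuity of the objective handles all three limits.
  have hobj : ∀ {u v : ℕ → Triple d r T} {a b : Triple d r T}, Tendsto u atTop (𝓝 a) →
      Tendsto v atTop (𝓝 b) → (∀ n, P.objective (u n) ≤ P.objective (v n)) →
      P.objective a ≤ P.objective b := fun hu hv h =>
    le_of_tendsto_of_tendsto' ((P.continuous_objective.tendsto _).comp hu)
      ((P.continuous_objective.tendsto _).comp hv) h
  refine P.mem_stationarySet_of_isArgmin ⟨?_, fun V hV => ?_⟩ ⟨Set.mem_univ _, fun V _ => ?_⟩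
    ⟨Set.mem_univ _, fun V _ => ?_⟩
  · exact (isClosed_nonnegSet r T).mem_of_tendsto hsH
      (Eventually.of_forall fun n => (hz.stepH (χ n)).1)
  · have h := hobj (hsH.prodMk_nhds (hpW.prodMk_nhds hpW'))
      ((tendsto_const_nhds (x := V)).prodMk_nhds (hpW.prodMk_nhds hpW')) fun n => by
        have h1 : P.objH _ _ _ ≤ P.objH _ _ V := (hz.stepH (χ n)).2 hV
        simp only [objective_eq_objH]
        linarith
    simp only [objective_eq_objH] at h
    change P.objH W W' H ≤ P.objH W W' V
    linarith
  · have h := hobj (hsH.prodMk_nhds (hsW.prodMk_nhds hsW'))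
      (hsH.prodMk_nhds ((tendsto_const_nhds (x := V)).prodMk_nhds hsW')) fun n => by
        have h1 : P.objW _ _ ≤ P.objW _ V := (hz.stepW (χ n)).2 (Set.mem_univ V)
        simp only [objective_eq_objW]
        linarith
    simp only [objective_eq_objW] at h
    change P.objW H W ≤ P.objW H V
    linarith
  · have h := hobj (hsH.prodMk_nhds (hsW.prodMk_nhds hsW'))
      (hsH.prodMk_nhds (hsW.prodMk_nhds (tendsto_const_nhds (x := V)))) fun n => by
        have h1 : P.objW' _ _ ≤ P.objW' _ V := (hz.stepW' (χ n)).2 (Set.mem_univ V)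
        simp only [objective_eq_objW]
        linarith
    simp only [objective_eq_objW] at h
    change P.objW' H W' ≤ P.objW' H V
    linarith

lemma exists_isCompact (hz : P.IsBCD z) (hxi : 0 ≤ P.xi) (hlam : 0 < P.lam)
    (hlam₁ : 0 < P.lam₁) (hlam₂ : 0 < P.lam₂) :
    ∃ K : Set (Triple d r T), IsCompact K ∧ ∀ j, z j ∈ K := by
  set c := P.objective (z 1)
  -- The initialization is added separately, as its objective is not bounded by `c`.
  refine ⟨insert (z 0) (entryBox r T (1 + c / P.lam) ×ˢ entryBox d r (1 + c / P.lam₁) ×ˢ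
    entryBox d r (1 + c / P.lam₂)), ((isCompact_entryBox _ _ _).prod
      ((isCompact_entryBox _ _ _).prod (isCompact_entryBox _ _ _))).insert _, fun j => ?_⟩
  rcases j with _ | j
  · exact Set.mem_insert _ _
  have hle : P.objective (z (j + 1)) ≤ c :=
    hz.antitone_objective hxi hlam₁ hlam₂ (Nat.zero_le j)
  have h1 := frobSq_nonneg (P.X - (z (j + 1)).2.1 * (z (j + 1)).1)
  have h2 := mul_nonneg hxi (frobSq_nonneg (P.Y - (z (j + 1)).2.2 * (z (j + 1)).1))
  have h3 := mul_nonneg hlam.le (P.reg.isAdmissible_penalty.nonneg (z (j + 1)).1)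
  have h4 := mul_nonneg hlam₁.le (frobSq_nonneg (z (j + 1)).2.1)
  have h5 := mul_nonneg hlam₂.le (frobSq_nonneg (z (j + 1)).2.2)
  simp only [objective] at hle
  refine Set.mem_insert_of_mem _ ⟨fun s t => ?_, fun s t => ?_, fun s t => ?_⟩
  · refine (P.reg.abs_apply_le_one_add_penalty _ s t).trans (add_le_add_right ?_ 1)
    rw [le_div_iff₀ hlam]
    linarith
  · refine (abs_apply_le_one_add_frobSq _ s t).trans (add_le_add_right ?_ 1)
    rw [le_div_iff₀ hlam₁]
    linarith
  · refine (abs_apply_le_one_add_frobSq _ s t).trans (add_le_add_right ?_ 1)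
    rw [le_div_iff₀ hlam₂]
    linarith

end IsBCD

end Problem

end BlockCoordinateDescent

/-- A sequence leaving an open `U ⊇ S` infinitely often would have a cluster point in the compact
set `K \ U`. -/
lemma tendsto_nhdsSet_of_mapClusterPt {E : Type*} [TopologicalSpace E] {z : ℕ → E} {K S : Set E}
    (hK : IsCompact K) (hzK : ∀ j, z j ∈ K) (hS : ∀ x, MapClusterPt x atTop z → x ∈ S) :
    Tendsto z atTop (𝓝ˢ S) := by
  refine (hasBasis_nhdsSet S).tendsto_right_iff.2 fun U hU => ?_
  by_contra hcon
  obtain ⟨x, hx, hcl⟩ := (hK.diff hU.1).exists_mapClusterPt_of_frequently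
    ((not_eventually.1 hcon).mono fun j hj => ⟨hzK j, hj⟩)
  exact hx.2 (hU.2 (hS x hcl))

end SSNMF

theorem theorem1 (d r T : ℕ) (P : SSNMF.Problem d r T)
    (hxi : 0 ≤ P.xi) (hlam : 0 ≤ P.lam) (hlam₁ : 0 < P.lam₁) (hlam₂ : 0 < P.lam₂) :
    -- projected subgradient descent solves every `H`-subproblem
    (∀ (W W' : Matrix (Fin d) (Fin r) ℝ) (α : ℕ → ℝ), SSNMF.IsStepSize α →
      (∀ h₀ : Matrix (Fin r) (Fin T) ℝ, ∃ h : ℕ → Matrix (Fin r) (Fin T) ℝ,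
        h 0 = h₀ ∧ SSNMF.IsProjectedSubgradient (P.objH W W') α h) ∧
      (∀ h : ℕ → Matrix (Fin r) (Fin T) ℝ,
        SSNMF.IsProjectedSubgradient (P.objH W W') α h →
        ∃ H : Matrix (Fin r) (Fin T) ℝ,
          SSNMF.IsArgmin (P.objH W W') (SSNMF.nonnegSet r T) H ∧ Tendsto h atTop (𝓝 H))) ∧
    -- block coordinate descent can be run from every initialization
    (∀ z₀ : SSNMF.Triple d r T, ∃ z : ℕ → SSNMF.Triple d r T, z 0 = z₀ ∧ P.IsBCD z) ∧
    (∀ z : ℕ → SSNMF.Triple d r T, P.IsBCD z →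
      -- every cluster point of the iterates is a stationary point
      (∀ z' : SSNMF.Triple d r T, MapClusterPt z' atTop z → z' ∈ P.stationarySet) ∧
      -- for a positive weight the iterates stay in a compact set and converge to the set of
      -- stationary points
      (0 < P.lam →
        (∃ K : Set (SSNMF.Triple d r T), IsCompact K ∧ ∀ j, z j ∈ K) ∧
        Tendsto z atTop (𝓝ˢ P.stationarySet))) := by
  refine ⟨fun W W' α hα => ?_, P.exists_isBCD hxi hlam hlam₁ hlam₂, fun z hz =>
    ⟨fun z' => hz.mem_stationarySet hxi hlam hlam₁ hlam₂, fun hpos => ?_⟩⟩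
  · have hadm := P.isAdmissible_objH hxi hlam W W'
    obtain ⟨x, hx⟩ := P.exists_isArgmin_objH hxi hlam W W'
    exact ⟨hadm.exists_projectedSubgradient α, fun h hh => hh.tendsto_argmin hadm hα hx⟩
  · obtain ⟨K, hK, hzK⟩ := hz.exists_isCompact hxi hpos hlam₁ hlam₂
    exact ⟨⟨K, hK, hzK⟩, SSNMF.tendsto_nhdsSet_of_mapClusterPt hK hzK fun _ =>
      hz.mem_stationarySet hxi hlam hlam₁ hlam₂⟩
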